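/- A finite simple graph $H$ is a minor of a finite simple graph $G$ if, up to isomorphism, $H$ can be obtained from a subgraph of $G$ by contracting edges, and a proper minor if moreover $H\not\cong G$. A graph $G$ is $k$-contraction-critical if its chromatic number is $k$ and every proper minor of $G$ is $(k-1)$-colorable. A graph is $t$-connected if it has more than $t$ vertices and deleting any set of fewer than $t$ vertices leaves a connected graph. Let $t\ge 6$ and $k\ge 2^{t-4}+2$ be integers. Then every finite $k$-contraction-critical graph $G$ is $t$-connected, except for the case where $t=k=6$ and $G$ is the complete graph $K_6$. -/

import Mathlib

universe u v

namespace ContractionCritical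

/-- The graph obtained from `G` by contracting all edges of the spanning subgraph `F` of `G`
(used for `F ≤ G`). Its vertices are the connected components of `F`, and two distinct components
are adjacent when some edge of `G` joins them; loops and parallel edges are discarded. -/
def contract {V : Type u} (G F : SimpleGraph V) : SimpleGraph F.ConnectedComponent where
  Adj c d := c ≠ d ∧ ∃ a b : V, F.connectedComponentMk a = c ∧ F.connectedComponentMk b = d ∧
    G.Adj a b
  symm := ⟨fun _ _ ⟨hne, a, b, ha, hb, hab⟩ => ⟨hne.symm, b, a, hb, ha, hab.symm⟩⟩
  loopless := ⟨fun _ h => h.1 rfl⟩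

/-- `H` is a minor of `G`: up to isomorphism, `H` is obtained from a subgraph of `G` by
contracting edges. -/
def IsMinor {W : Type v} {V : Type u} (H : SimpleGraph W) (G : SimpleGraph V) : Prop :=
  ∃ (G' : G.Subgraph) (F : SimpleGraph G'.verts), F ≤ G'.coe ∧ Nonempty (H ≃g contract G'.coe F)

/-- A proper minor of `G` is a minor of `G` that is not (isomorphic to) `G` itself. -/
def IsProperMinor {W : Type v} {V : Type u} (H : SimpleGraph W) (G : SimpleGraph V) : Prop :=
  IsMinor H G ∧ IsEmpty (H ≃g G)

/-- `G` is `k`-contraction-critical: its chromatic number is `k`, and every proper minor of `G` is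
`(k - 1)`-colorable. Every minor of `G` is isomorphic to one on a vertex type in the universe of
the vertex type of `G`. -/
def IsContractionCritical {V : Type u} (k : ℕ) (G : SimpleGraph V) : Prop :=
  G.chromaticNumber = k ∧
    ∀ (W : Type u) (H : SimpleGraph W), IsProperMinor H G → H.Colorable (k - 1)

/-- `G` is `t`-connected: it has more than `t` vertices, and deleting fewer than `t` vertices
always leaves a connected graph. -/
def IsVertexConnected {V : Type u} (t : ℕ) (G : SimpleGraph V) : Prop :=
  (t : ℕ∞) < ENat.card V ∧
    ∀ S : Set V, S.encard < t → (G.induce Sᶜ).Connected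

end ContractionCritical

/-! Suppose fewer than `t` vertices separate `a` from `b`, and let `S` be a minimal such set, so
every vertex of `S` has neighbours in both components. Let `C` be the set of `k - 1` colours. If `S`
is a clique, colourings of the two sides glue. Otherwise fix an independent triple `I ⊆ S`, or a
nonadjacent pair if there is none. It suffices to colour each side, `S` included, so that `S` is
partitioned into `I` and singletons: two such colourings glue, and `G` is not `(k - 1)`-colourable.

Contracting the opposite component together with `I` gives a colouring `φ` with `I` as a class on
`S` (`Critical.exists_class`). Take `φ` with as many colours on `S \ I` as possible. If a colour
repeats there, maximality joins its vertices by Kempe chains for every colour unused on `S`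
(`linked_of_maximal`). Contracting such chains, with a private colour for each vertex, turns each
class on `S \ I` into a connected bag. A colouring `g` of the contraction may still merge classes.
So each set `M` of classes that might merge gets its own private colour: if the chains of two
classes of `M` for that colour touch, they are put into the bags, which become adjacent, and `M`
cannot merge; if none touch, `M` can be recoloured with that colour by independent Kempe changes.
Hence `φ` can be changed to induce the partition of `g` on `S`, and gluing colours `G`
(`FrameColoring.colorable`), a contradiction. So `φ` is injective on `S \ I`
(`Critical.exists_injOn`).

The bound on `k` counts private colours: `|S|` for the vertices, plus one for each `M`; these sets
live on at most `|S| - 4` colours (`exists_small_colors`). -/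

namespace ContractionCritical

/-! ### Walks confined to a vertex set -/

section Linked

variable {V : Type u} {G : SimpleGraph V}

/-- `y` can be reached from `x` by a walk of `G` all of whose vertices after `x` satisfy `P`. -/
def Linked (G : SimpleGraph V) (P : V → Prop) (x y : V) : Prop :=
  Relation.ReflTransGen (fun u w => G.Adj u w ∧ P w) x y

theorem Linked.refl (P : V → Prop) (x : V) : Linked G P x x := Relation.ReflTransGen.refl

theorem Linked.tail {P : V → Prop} {x y z : V} (h : Linked G P x y) (hyz : G.Adj y z) (hz : P z) :
    Linked G P x z := Relation.ReflTransGen.tail h ⟨hyz, hz⟩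

theorem Linked.pred {P : V → Prop} {x y : V} (h : Linked G P x y) (hx : P x) : P y := by
  rcases Relation.ReflTransGen.cases_tail h with h | ⟨_, _, h⟩
  · exact h ▸ hx
  · exact h.2

/-- Either a walk avoids `X`, or it has an initial segment that avoids `X` and ends next to `X`. -/
theorem Linked.avoid_or_adj {P : V → Prop} {X : Set V} {x y : V} (h : Linked G P x y) :
    Linked G (fun v => P v ∧ v ∉ X) x y ∨
      ∃ v w, Linked G (fun v => P v ∧ v ∉ X) x v ∧ w ∈ X ∧ G.Adj v w := by
  induction h with
  | refl => exact Or.inl (Linked.refl _ _)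
  | @tail b c _ hbc ih =>
    rcases ih with ih | ih
    · by_cases hc : c ∈ X
      · exact Or.inr ⟨b, c, ih, hc, hbc.1⟩
      · exact Or.inl (ih.tail hbc.1 ⟨hbc.2, hc⟩)
    · exact Or.inr ih

/-- A walk whose vertices all lie in a set on which adjacency in `G` implies adjacency in `F` gives
reachability in `F`. -/
theorem Linked.reachable {P : V → Prop} {F : SimpleGraph V} {x y : V} (h : Linked G P x y)
    (hF : ∀ u w, Linked G P x u → Linked G P x w → G.Adj u w → F.Adj u w) : F.Reachable x y := by
  induction h with
  | refl => exact SimpleGraph.Reachable.refl _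
  | @tail b c hb hbc ih =>
    have hb' : Linked G P x b := hb
    exact ih.trans (hF b c hb (hb'.tail hbc.1 hbc.2) hbc.1).reachable

end Linked

/-! ### Kempe chains -/

section Kempe

variable {V : Type u} {G : SimpleGraph V} {C : Type v} {R : Set V} {φ : V → C}

/-- `φ` is a proper colouring of `G` minus the set `R`. -/
def ProperOff (G : SimpleGraph V) (R : Set V) (φ : V → C) : Prop :=
  ∀ ⦃u w⦄, u ∉ R → w ∉ R → G.Adj u w → φ u ≠ φ w

/-- The vertices outside `R` of colour `i` or `j`. -/
def TwoColored (R : Set V) (φ : V → C) (i j : C) (v : V) : Prop :=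
  v ∉ R ∧ (φ v = i ∨ φ v = j)

theorem swap_mem_pair [DecidableEq C] {i j a : C} (h : a = i ∨ a = j) :
    Equiv.swap i j a = i ∨ Equiv.swap i j a = j := by
  rcases h with rfl | rfl
  · exact Or.inr (Equiv.swap_apply_left _ _)
  · exact Or.inl (Equiv.swap_apply_right _ _)

open Classical in
theorem ProperOff.kempe_swap (h : ProperOff G R φ) {x : V} (hx : x ∉ R) (j : C) :
    ProperOff G R (fun v => if Linked G (TwoColored R φ (φ x) j) x v
      then Equiv.swap (φ x) j (φ v) else φ v) := by
  have key : ∀ ⦃u w⦄, u ∉ R → w ∉ R → G.Adj u w →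
      Linked G (TwoColored R φ (φ x) j) x u → ¬ Linked G (TwoColored R φ (φ x) j) x w →
      Equiv.swap (φ x) j (φ u) ≠ φ w := by
    intro u w _ hw huw hu hnw he
    have hu' : TwoColored R φ (φ x) j u := hu.pred ⟨hx, Or.inl rfl⟩
    have := swap_mem_pair hu'.2
    rw [he] at this
    exact hnw (hu.tail huw ⟨hw, this⟩)
  intro u w hu hw huw
  dsimp only
  split_ifs with h1 h2 h2
  · exact fun he => h hu hw huw ((Equiv.swap _ _).injective he)
  · exact key hu hw huw h1 h2
  · exact (key hw hu huw.symm h2 h1).symm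
  · exact h hu hw huw

open Classical in
/-- If `φ` uses as many colours as possible on `S \ I`, then any two vertices of `S \ I` of the same
colour are joined by a Kempe chain for each colour that is not used on `S`. -/
theorem linked_of_maximal {S I : Finset V} {ι : C} (hSR : ∀ x ∈ S, x ∉ R)
    (h : ProperOff G R φ) (hι : ∀ x ∈ S, φ x = ι ↔ x ∈ I)
    (hmax : ∀ ψ : V → C, ProperOff G R ψ → (∀ x ∈ S, ψ x = ι ↔ x ∈ I) →
      ((S \ I).image ψ).card ≤ ((S \ I).image φ).card)
    {x y : V} (hx : x ∈ S) (hxI : x ∉ I) (hy : y ∈ S) (hyI : y ∉ I) (hxy : φ x = φ y)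
    {j : C} (hj : ∀ z ∈ S, j ≠ φ z) (hjι : j ≠ ι) :
    Linked G (TwoColored R φ (φ x) j) x y := by
  by_contra hcon
  have hxι : φ x ≠ ι := fun e => hxI ((hι x hx).1 e)
  set ψ : V → C := fun v => if Linked G (TwoColored R φ (φ x) j) x v
      then Equiv.swap (φ x) j (φ v) else φ v with hψ
  have hψx : ψ x = j := by simp [hψ, Linked.refl]
  have hψy : ψ y = φ x := by
    simp only [hψ, if_neg hcon]
    exact hxy.symm
  have hψS : ∀ z ∈ S, φ z ≠ φ x → ψ z = φ z := by
    intro z hz hne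
    simp only [hψ]
    split_ifs
    · exact Equiv.swap_apply_of_ne_of_ne hne (hj z hz).symm
    · rfl
  have hψS' : ∀ z ∈ S, φ z = φ x → ψ z = φ x ∨ ψ z = j := by
    intro z hz he
    simp only [hψ]
    split_ifs
    · exact Or.inr (by rw [he, Equiv.swap_apply_left])
    · exact Or.inl he
  have hψι : ∀ z ∈ S, ψ z = ι ↔ z ∈ I := by
    intro z hz
    by_cases hne : φ z = φ x
    · have h1 : z ∉ I := fun hzI => hxι (hne ▸ (hι z hz).2 hzI)
      have h2 : ψ z ≠ ι := by
        rcases hψS' z hz hne with e | e <;> rw [e] <;> assumption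
      simp [h1, h2]
    · rw [hψS z hz hne]; exact hι z hz
  have hle := hmax ψ (h.kempe_swap (hSR x hx) j) hψι
  -- After the swap `x` has colour `j` while `y` keeps the old colour of `x`: no colour is lost and
  -- `j` is gained.
  have hsub : insert j ((S \ I).image φ) ⊆ (S \ I).image ψ := by
    intro i hi
    rw [Finset.mem_insert] at hi
    rcases hi with rfl | hi
    · exact Finset.mem_image.2 ⟨x, Finset.mem_sdiff.2 ⟨hx, hxI⟩, hψx⟩
    · obtain ⟨z, hz, rfl⟩ := Finset.mem_image.1 hi
      by_cases hne : φ z = φ x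
      · exact Finset.mem_image.2 ⟨y, Finset.mem_sdiff.2 ⟨hy, hyI⟩, by rw [hψy, hne]⟩
      · exact Finset.mem_image.2 ⟨z, hz, hψS z (Finset.mem_sdiff.1 hz).1 hne⟩
  have hnot : j ∉ (S \ I).image φ := by
    intro hi
    obtain ⟨z, hz, e⟩ := Finset.mem_image.1 hi
    exact hj z (Finset.mem_sdiff.1 hz).1 e.symm
  have := Finset.card_le_card hsub
  rw [Finset.card_insert_of_notMem hnot] at this
  omega

end Kempe

end ContractionCritical

/-! ### Kempe frames and their bags -/

namespace ContractionCritical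

/-- A colouring `φ` of `G` minus `R`, whose colour class on `S` for the colour `ι` is `I`, together
with private colours `ν w` for the vertices `w` of `S` and `μ M` for some sets `M` of colours. -/
structure KempeFrame {V : Type u} (G : SimpleGraph V) (S I : Finset V) (R : Set V)
    (C : Type v) where
  φ : V → C
  ι : C
  proper : ProperOff G R φ
  off : ∀ x ∈ S, x ∉ R
  class_iff : ∀ x ∈ S, φ x = ι ↔ x ∈ I
  sub : I ⊆ S
  ν : V → C
  ν_inj : Set.InjOn ν S
  ν_eq : ∀ w ∈ S, ∀ x ∈ S, ν w = φ x → ν w = φ w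
  𝓜 : Finset (Finset C)
  μ : Finset C → C
  μ_inj : Set.InjOn μ 𝓜
  μ_ne_ν : ∀ M ∈ 𝓜, ∀ w ∈ S, μ M ≠ ν w
  μ_ne_φ : ∀ M ∈ 𝓜, ∀ w ∈ S, μ M ≠ φ w
  linked : ∀ x ∈ S, ∀ y ∈ S, x ∉ I → y ∉ I → φ x = φ y → (∀ z ∈ S, ν x ≠ φ z) →
    Linked G (TwoColored R φ (φ x) (ν x)) x y

namespace KempeFrame

variable {V : Type u} {G : SimpleGraph V} {S I : Finset V} {R : Set V} {C : Type v}
  (f : KempeFrame G S I R C)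

/-- The Kempe chain through `x` for the colour of `x` and the colour `j`. -/
def chain (x : V) (j : C) : Set V := {v | Linked G (TwoColored R f.φ (f.φ x) j) x v}

theorem self_mem_chain (x : V) (j : C) : x ∈ f.chain x j := Linked.refl _ _

variable {f} in
theorem twoColored_of_mem_chain {x v : V} {j : C} (hx : x ∈ S) (h : v ∈ f.chain x j) :
    TwoColored R f.φ (f.φ x) j v :=
  Linked.pred h ⟨f.off x hx, Or.inl rfl⟩

/-- The pair `p` consists of two vertices of `S \ I` of different colours in `M` whose Kempe chains
for the private colour of `M` meet or are joined by an edge. -/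
def TouchPair (M : Finset C) (p : V × V) : Prop :=
  p.1 ∈ S ∧ p.1 ∉ I ∧ p.2 ∈ S ∧ p.2 ∉ I ∧ f.φ p.1 ∈ M ∧ f.φ p.2 ∈ M ∧ f.φ p.1 ≠ f.φ p.2 ∧
    ∃ a b, a ∈ f.chain p.1 (f.μ M) ∧ b ∈ f.chain p.2 (f.μ M) ∧ (a = b ∨ G.Adj a b)

/-- Some two colours of `M` have Kempe chains that touch. -/
def Touched (M : Finset C) : Prop := ∃ p, f.TouchPair M p

/-- The bags to be contracted, one for each colour of `S \ I`. -/
inductive Bag : C → V → Prop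
  | connector {w v : V} (hw : w ∈ S) (hwI : w ∉ I) (h : v ∈ f.chain w (f.ν w)) : Bag (f.φ w) v
  | first {M : Finset C} (hM : M ∈ f.𝓜) (ht : f.Touched M) {v : V}
      (h : v ∈ f.chain ht.choose.1 (f.μ M)) : Bag (f.φ ht.choose.1) v
  | second {M : Finset C} (hM : M ∈ f.𝓜) (ht : f.Touched M) {v : V}
      (h : Linked G (fun v => TwoColored R f.φ (f.φ ht.choose.2) (f.μ M) v ∧
        v ∉ f.chain ht.choose.1 (f.μ M)) ht.choose.2 v) : Bag (f.φ ht.choose.2) v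

variable {f}

theorem ν_ne_color {w x : V} (hw : w ∈ S) (hx : x ∈ S) (h : f.φ x ≠ f.φ w) : f.ν w ≠ f.φ x :=
  fun e => h (e ▸ f.ν_eq w hw x hx e)

theorem Touched.spec {M : Finset C} (ht : f.Touched M) : f.TouchPair M ht.choose := ht.choose_spec

theorem Touched.snd_notMem {M : Finset C} (hM : M ∈ f.𝓜) (ht : f.Touched M) :
    ht.choose.2 ∉ f.chain ht.choose.1 (f.μ M) := by
  obtain ⟨h1, h1', h2, h2', -, -, hne, -⟩ := ht.spec
  intro h
  rcases (twoColored_of_mem_chain h1 h).2 with e | e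
  · exact hne e.symm
  · exact f.μ_ne_φ M hM _ h2 e.symm

theorem Bag.color_mem {i : C} {v : V} (h : f.Bag i v) : ∃ x ∈ S, x ∉ I ∧ f.φ x = i := by
  cases h with
  | connector hw hwI => exact ⟨_, hw, hwI, rfl⟩
  | first hM ht => exact ⟨_, ht.spec.1, ht.spec.2.1, rfl⟩
  | second hM ht => exact ⟨_, ht.spec.2.2.1, ht.spec.2.2.2.1, rfl⟩

theorem second_pred {M : Finset C} (hM : M ∈ f.𝓜) (ht : f.Touched M) {v : V}
    (h : Linked G (fun v => TwoColored R f.φ (f.φ ht.choose.2) (f.μ M) v ∧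
        v ∉ f.chain ht.choose.1 (f.μ M)) ht.choose.2 v) :
    TwoColored R f.φ (f.φ ht.choose.2) (f.μ M) v ∧ v ∉ f.chain ht.choose.1 (f.μ M) :=
  h.pred ⟨⟨f.off _ ht.spec.2.2.1, Or.inl rfl⟩, ht.snd_notMem hM⟩

theorem Bag.off {i : C} {v : V} (h : f.Bag i v) : v ∉ R := by
  cases h with
  | connector hw hwI h => exact (twoColored_of_mem_chain hw h).1
  | first hM ht h => exact (twoColored_of_mem_chain ht.spec.1 h).1
  | second hM ht h => exact (second_pred hM ht h).1.1

/-- The colours that occur in a bag. -/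
theorem Bag.color {i : C} {v : V} (h : f.Bag i v) :
    f.φ v = i ∨ (∃ w ∈ S, w ∉ I ∧ f.φ w = i ∧ f.φ v = f.ν w) ∨
      ∃ M ∈ f.𝓜, ∃ ht : f.Touched M, f.φ v = f.μ M ∧
        ((i = f.φ ht.choose.1 ∧ v ∈ f.chain ht.choose.1 (f.μ M)) ∨
          (i = f.φ ht.choose.2 ∧ v ∉ f.chain ht.choose.1 (f.μ M))) := by
  cases h with
  | connector hw hwI h =>
    rcases (twoColored_of_mem_chain hw h).2 with e | e
    · exact Or.inl e
    · exact Or.inr (Or.inl ⟨_, hw, hwI, rfl, e⟩)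
  | first hM ht h =>
    rcases (twoColored_of_mem_chain ht.spec.1 h).2 with e | e
    · exact Or.inl e
    · exact Or.inr (Or.inr ⟨_, hM, ht, e, Or.inl ⟨rfl, h⟩⟩)
  | second hM ht h =>
    obtain ⟨h1, h2⟩ := second_pred hM ht h
    rcases h1.2 with e | e
    · exact Or.inl e
    · exact Or.inr (Or.inr ⟨_, hM, ht, e, Or.inr ⟨rfl, h2⟩⟩)

/-- Among the colours of `S \ I`, only `i` occurs in the bag of `i`. -/
theorem Bag.color_eq {i : C} {v x : V} (h : f.Bag i v) (hx : x ∈ S) (hvx : f.φ v = f.φ x) :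
    f.φ x = i := by
  rcases h.color with e | ⟨w, hw, -, e1, e2⟩ | ⟨M, hM, ht, e, -⟩
  · rw [← e, hvx]
  · rw [← e1]
    by_contra hne
    exact ν_ne_color hw hx hne (e2 ▸ hvx)
  · exact absurd (e ▸ hvx) (f.μ_ne_φ M hM x hx)

/-- The colour of a vertex determines its bag: a colour of `S \ I` occurs only in its own bag, any
other private colour `ν w` only in connectors of `w`, and `μ M` only in the two bags chosen for `M`.
These last two are kept apart by cutting the first chain out of the second. -/
theorem Bag.unique {i j : C} {v : V} (hi : f.Bag i v) (hj : f.Bag j v) : i = j := by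
  obtain ⟨x, hx, -, rfl⟩ := hi.color_mem
  obtain ⟨y, hy, -, rfl⟩ := hj.color_mem
  rcases hi.color with e | ⟨w, hw, -, e1, e2⟩ | ⟨M, hM, ht, e, hr⟩
  · exact hj.color_eq hx e
  · rcases hj.color with e' | ⟨w', hw', -, e1', e2'⟩ | ⟨M', hM', ht', e', -⟩
    · exact (hi.color_eq hy e').symm
    · rw [← e1, ← e1', f.ν_inj hw hw' (e2.symm.trans e2')]
    · exact absurd (e'.symm.trans e2) (f.μ_ne_ν M' hM' w hw)
  · rcases hj.color with e' | ⟨w', hw', -, e1', e2'⟩ | ⟨M', hM', ht', e', hr'⟩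
    · exact (hi.color_eq hy e').symm
    · exact absurd (e.symm.trans e2') (f.μ_ne_ν M hM w' hw')
    · obtain rfl : M = M' := f.μ_inj hM hM' (e.symm.trans e')
      rcases hr with ⟨h1, h2⟩ | ⟨h1, h2⟩ <;> rcases hr' with ⟨h3, h4⟩ | ⟨h3, h4⟩
      · exact h1.trans h3.symm
      · exact absurd h2 h4
      · exact absurd h4 h2
      · exact h1.trans h3.symm

theorem Bag.ne_ι {i : C} {v u₀ : V} (hu₀ : u₀ ∈ I) (h : f.Bag i v) : f.φ v ≠ f.ι := by
  intro e
  have h0 : f.φ u₀ = f.ι := (f.class_iff _ (f.sub hu₀)).2 hu₀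
  obtain ⟨x, hx, hxI, e'⟩ := h.color_mem
  exact hxI ((f.class_iff x hx).1
    (e'.trans ((h.color_eq (f.sub hu₀) (e.trans h0.symm)).symm.trans h0)))

end KempeFrame
end ContractionCritical

/-! ### Contracting the bags -/

namespace ContractionCritical

namespace KempeFrame

variable {V : Type u} {G : SimpleGraph V} {S I : Finset V} {R : Set V} {C : Type v}
  (f : KempeFrame G S I R C)

/-- The edges to be contracted: those inside a bag, and those off `R` that avoid all bags. -/
def contracted : SimpleGraph V where
  Adj u v := G.Adj u v ∧ u ∉ R ∧ v ∉ R ∧ ∀ i, f.Bag i u ↔ f.Bag i v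
  symm := ⟨fun _ _ h => ⟨h.1.symm, h.2.2.1, h.2.1, fun i => (h.2.2.2 i).symm⟩⟩
  loopless := ⟨fun _ h => h.1.ne rfl⟩

theorem contracted_le : f.contracted ≤ G := fun _ _ h => h.1

variable {f}

theorem bag_iff_of_reachable {u v : V} (h : f.contracted.Reachable u v) (i : C) :
    f.Bag i u ↔ f.Bag i v := by
  obtain ⟨p⟩ := h
  induction p with
  | nil => rfl
  | cons h _ ih => exact (h.2.2.2 i).trans ih

theorem Bag.contracted_adj {i : C} {u v : V} (hu : f.Bag i u) (hv : f.Bag i v) (h : G.Adj u v) :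
    f.contracted.Adj u v :=
  ⟨h, hu.off, hv.off, fun _ => ⟨fun h => h.unique hu ▸ hv, fun h => h.unique hv ▸ hu⟩⟩

theorem reachable_of_linked {P : V → Prop} {i : C} {x v : V}
    (h : Linked G P x v) (hb : ∀ u, Linked G P x u → f.Bag i u) : f.contracted.Reachable x v :=
  h.reachable fun u w hu hw huw => (hb u hu).contracted_adj (hb w hw) huw

theorem bag_self {x : V} (hx : x ∈ S) (hxI : x ∉ I) : f.Bag (f.φ x) x :=
  .connector hx hxI (f.self_mem_chain _ _)

/-- The chain for `ν x` is available unless `ν x` occurs on `S`, and then `ν x = φ x`. As `ν` is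
injective, this cannot happen to two distinct vertices of the same colour, so one of the two chains
serves. -/
theorem reachable_of_color_eq {x y : V} (hx : x ∈ S) (hxI : x ∉ I) (hy : y ∈ S) (hyI : y ∉ I)
    (h : f.φ x = f.φ y) : f.contracted.Reachable x y := by
  by_cases h1 : ∀ z ∈ S, f.ν x ≠ f.φ z
  · exact reachable_of_linked (f.linked x hx y hy hxI hyI h h1) fun u hu => .connector hx hxI hu
  by_cases h2 : ∀ z ∈ S, f.ν y ≠ f.φ z
  · exact (reachable_of_linked (f.linked y hy x hx hyI hxI h.symm h2)
      fun u hu => .connector hy hyI hu).symm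
  push Not at h1 h2
  obtain ⟨a, ha, ea⟩ := h1
  obtain ⟨b, hb, eb⟩ := h2
  have := f.ν_inj hx hy ((f.ν_eq x hx a ha ea).trans (h.trans (f.ν_eq y hy b hb eb).symm))
  exact this ▸ .refl _

theorem Bag.reachable {i : C} {v x : V} (h : f.Bag i v) (hx : x ∈ S) (hxI : x ∉ I)
    (hxi : f.φ x = i) : f.contracted.Reachable x v := by
  cases h with
  | connector hw hwI h =>
    exact (reachable_of_color_eq hx hxI hw hwI hxi).trans
      (reachable_of_linked h fun u hu => .connector hw hwI hu)
  | first hM ht h =>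
    exact (reachable_of_color_eq hx hxI ht.spec.1 ht.spec.2.1 hxi).trans
      (reachable_of_linked h fun u hu => .first hM ht hu)
  | second hM ht h =>
    exact (reachable_of_color_eq hx hxI ht.spec.2.2.1 ht.spec.2.2.2.1 hxi).trans
      (reachable_of_linked h fun u hu => .second hM ht hu)

/-- Follow the second chain from its root to the touching point. If it avoids the first chain, the
touching edge joins the bags; otherwise the first edge entering the first chain does. -/
theorem Touched.exists_adj {M : Finset C} (hM : M ∈ f.𝓜) (ht : f.Touched M) :
    ∃ i ∈ M, ∃ j ∈ M, i ≠ j ∧ ∃ u v, f.Bag i u ∧ f.Bag j v ∧ G.Adj u v := by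
  obtain ⟨-, -, -, -, h5, h6, hne, a, b, ha, hb, hab⟩ := ht.spec
  refine ⟨_, h5, _, h6, hne, ?_⟩
  rcases Linked.avoid_or_adj (X := f.chain ht.choose.1 (f.μ M)) hb with h | ⟨v, w, h, hw, hvw⟩
  · rcases hab with rfl | hab
    · exact absurd ha (second_pred hM ht h).2
    · exact ⟨a, b, .first hM ht ha, .second hM ht h, hab⟩
  · exact ⟨w, v, .first hM ht hw, .second hM ht h, hvw.symm⟩

/-- Criticality needs a nontrivial contraction. If `b` is in no bag, the edge `u₀ b` is contracted;
otherwise the bag of `b` links `b` to a vertex of `S`, which is not `b`. -/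
theorem contracted_ne_bot {u₀ b : V} (hu₀ : u₀ ∈ I) (hb : b ∉ R) (hbS : b ∉ S)
    (h : G.Adj u₀ b) : f.contracted ≠ ⊥ := by
  intro hbot
  have hu : ∀ i, ¬ f.Bag i u₀ := fun i hi =>
    hi.ne_ι hu₀ ((f.class_iff _ (f.sub hu₀)).2 hu₀)
  by_cases hfree : ∀ i, ¬ f.Bag i b
  · have : f.contracted.Adj u₀ b :=
      ⟨h, f.off _ (f.sub hu₀), hb, fun i => iff_of_false (hu i) (hfree i)⟩
    rw [hbot] at this
    exact this
  · push Not at hfree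
    obtain ⟨i, hi⟩ := hfree
    obtain ⟨x, hx, hxI, hxi⟩ := hi.color_mem
    have := hi.reachable hx hxI hxi
    rw [hbot, SimpleGraph.reachable_bot] at this
    exact hbS (this ▸ hx)

end KempeFrame

/-- A colouring of the graph obtained from `G` by contracting the edges of a Kempe frame. -/
structure FrameColoring {V : Type u} {G : SimpleGraph V} {S I : Finset V} {R : Set V} {C : Type v}
    (f : KempeFrame G S I R C) where
  col : V → C
  eq_of_reachable : ∀ u v, f.contracted.Reachable u v → col u = col v
  ne_of_adj : ∀ u v, G.Adj u v → ¬ f.contracted.Reachable u v → col u ≠ col v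
  nonempty : I.Nonempty
  mem_of_indep : ∀ T ⊆ S, (∀ x ∈ T, x ∉ I) → (∀ x ∈ T, ∀ y ∈ T, ¬ G.Adj x y) →
    (∀ x ∈ T, ∀ y ∈ S, y ∉ I → f.φ x = f.φ y → y ∈ T) →
    ∀ M : Finset C, 2 ≤ M.card → (∀ i, i ∈ M ↔ ∃ x ∈ T, f.φ x = i) → M ∈ f.𝓜

/-! ### Recolouring `φ` to match a colouring of the contraction -/

namespace FrameColoring

variable {V : Type u} {G : SimpleGraph V} {S I : Finset V} {R : Set V} {C : Type v}
  {f : KempeFrame G S I R C} (g : FrameColoring f)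

theorem col_eq_of_color_eq {x y : V} (hx : x ∈ S) (hxI : x ∉ I) (hy : y ∈ S) (hyI : y ∉ I)
    (h : f.φ x = f.φ y) : g.col x = g.col y :=
  g.eq_of_reachable _ _ (KempeFrame.reachable_of_color_eq hx hxI hy hyI h)

theorem col_ne_of_bag {i j : C} {u v : V} (hu : f.Bag i u) (hv : f.Bag j v) (hij : i ≠ j)
    (h : G.Adj u v) : g.col u ≠ g.col v :=
  g.ne_of_adj _ _ h fun hr => hij (((KempeFrame.bag_iff_of_reachable hr i).1 hu).unique hv)

open Classical in
/-- The colours of the classes of `S \ I` that `g` gives the colour `t`. -/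
noncomputable def merged (t : C) : Finset C := ((S \ I).filter (fun x => g.col x = t)).image f.φ

theorem mem_merged {t i : C} : i ∈ g.merged t ↔ ∃ x ∈ S, x ∉ I ∧ g.col x = t ∧ f.φ x = i := by
  simp [merged, and_assoc]

theorem mem_merged_self {x : V} (hx : x ∈ S) (hxI : x ∉ I) : f.φ x ∈ g.merged (g.col x) :=
  g.mem_merged.2 ⟨x, hx, hxI, rfl, rfl⟩

theorem col_eq_of_mem_merged {x : V} (hx : x ∈ S) (hxI : x ∉ I) {t : C}
    (h : f.φ x ∈ g.merged t) : g.col x = t := by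
  obtain ⟨y, hy, hyI, e, e'⟩ := g.mem_merged.1 h
  rw [← e, g.col_eq_of_color_eq hx hxI hy hyI e'.symm]

theorem merged_mem {t : C} (h : 2 ≤ (g.merged t).card) : g.merged t ∈ f.𝓜 := by
  classical
  refine g.mem_of_indep ((S \ I).filter (fun x => g.col x = t)) ?_ ?_ ?_ ?_ _ h ?_
  · exact (Finset.filter_subset _ _).trans Finset.sdiff_subset
  · intro x hx
    simp only [Finset.mem_filter, Finset.mem_sdiff] at hx
    exact hx.1.2
  · intro x hx y hy hxy
    simp only [Finset.mem_filter, Finset.mem_sdiff] at hx hy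
    exact g.col_ne_of_bag (KempeFrame.bag_self hx.1.1 hx.1.2) (KempeFrame.bag_self hy.1.1 hy.1.2)
      (f.proper (f.off _ hx.1.1) (f.off _ hy.1.1) hxy) hxy (hx.2.trans hy.2.symm)
  · intro x hx y hy hyI hxy
    simp only [Finset.mem_filter, Finset.mem_sdiff] at hx ⊢
    exact ⟨⟨hy, hyI⟩, (g.col_eq_of_color_eq hy hyI hx.1.1 hx.1.2 hxy.symm).trans hx.2⟩
  · intro i
    simp [merged]

/-- A touched set has two adjacent bags, which `g` colours differently, whereas all bags of
`g.merged t` have colour `t`. -/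
theorem merged_not_touched {t : C} (h : 2 ≤ (g.merged t).card) : ¬ f.Touched (g.merged t) := by
  intro ht
  obtain ⟨i, hi, j, hj, hij, u, v, hu, hv, huv⟩ := ht.exists_adj (g.merged_mem h)
  have key : ∀ {i u}, i ∈ g.merged t → f.Bag i u → g.col u = t := by
    intro i u hi hu
    obtain ⟨x, hx, hxI, e, e'⟩ := g.mem_merged.1 hi
    rw [← g.eq_of_reachable _ _ (hu.reachable hx hxI e'), e]
  exact g.col_ne_of_bag hu hv hij huv ((key hi hu).trans (key hj hv).symm)

open Classical in
/-- The colour that replaces `t`. -/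
noncomputable def γ (t : C) : C :=
  if 2 ≤ (g.merged t).card then f.μ (g.merged t) else
  if h : (g.merged t).Nonempty then h.choose else
  if h : ∃ x ∈ I, g.col x = t then f.ν h.choose else f.ι

/-- Merged classes take the private colour of the merge, a lone class keeps its colour, and a colour
seen only on `I` becomes the private colour of a vertex of `I`. The default `ι`, for colours absent
from `S`, makes the swap in `recolored` trivial. -/
theorem γ_cases (t : C) :
    (2 ≤ (g.merged t).card ∧ g.γ t = f.μ (g.merged t)) ∨
    (∃ y ∈ S, y ∉ I ∧ g.col y = t ∧ g.γ t = f.φ y ∧ ∀ i ∈ g.merged t, i = f.φ y) ∨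
    (g.merged t = ∅ ∧ ∃ x ∈ I, g.col x = t ∧ g.γ t = f.ν x) ∨
    ((∀ x ∈ S, g.col x ≠ t) ∧ g.γ t = f.ι) := by
  by_cases h1 : 2 ≤ (g.merged t).card
  · exact Or.inl ⟨h1, if_pos h1⟩
  by_cases h2 : (g.merged t).Nonempty
  · obtain ⟨y, hy, hyI, e, e'⟩ := g.mem_merged.1 h2.choose_spec
    refine Or.inr (Or.inl ⟨y, hy, hyI, e, ?_, fun i hi => ?_⟩)
    · rw [γ, if_neg h1, dif_pos h2, e']
    · exact Finset.card_le_one.1 (by omega) _ hi _ (e' ▸ h2.choose_spec)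
  by_cases h3 : ∃ x ∈ I, g.col x = t
  · refine Or.inr (Or.inr (Or.inl
      ⟨Finset.not_nonempty_iff_eq_empty.1 h2, _, h3.choose_spec.1, h3.choose_spec.2, ?_⟩))
    rw [γ, if_neg h1, dif_neg h2, dif_pos h3]
  · refine Or.inr (Or.inr (Or.inr ⟨fun x hx e => ?_, ?_⟩))
    · by_cases hxI : x ∈ I
      · exact h3 ⟨x, hxI, e⟩
      · exact h2 ⟨_, e ▸ g.mem_merged_self hx hxI⟩
    · rw [γ, if_neg h1, dif_neg h2, dif_neg h3]

theorem γ_col_cases {x : V} (hx : x ∈ S) (hxI : x ∉ I) :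
    (2 ≤ (g.merged (g.col x)).card ∧ g.γ (g.col x) = f.μ (g.merged (g.col x))) ∨
    (g.γ (g.col x) = f.φ x ∧ ∀ i ∈ g.merged (g.col x), i = f.φ x) := by
  have hm := g.mem_merged_self hx hxI
  rcases g.γ_cases (g.col x) with h | ⟨y, hy, hyI, -, h, h'⟩ | ⟨h, -⟩ | ⟨h, -⟩
  · exact Or.inl h
  · rw [h, ← h' _ hm] at *
    exact Or.inr ⟨rfl, h'⟩
  · rw [h] at hm; simp at hm
  · exact absurd rfl (h x hx)

theorem φ_of_mem {x : V} (hx : x ∈ I) : f.φ x = f.ι := (f.class_iff x (f.sub hx)).2 hx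

theorem φ_ne_ι {x : V} (hx : x ∈ S) (hxI : x ∉ I) : f.φ x ≠ f.ι :=
  fun e => hxI ((f.class_iff x hx).1 e)

theorem ν_ne_φ_of_mem {x y : V} (hx : x ∈ I) (hy : y ∈ S) (hyI : y ∉ I) : f.ν x ≠ f.φ y :=
  KempeFrame.ν_ne_color (f.sub hx) hy fun e => φ_ne_ι hy hyI (e.trans (φ_of_mem hx))

include g in
theorem μ_ne_ι {M : Finset C} (hM : M ∈ f.𝓜) : f.μ M ≠ f.ι := by
  obtain ⟨u, hu⟩ := g.nonempty
  exact φ_of_mem hu ▸ f.μ_ne_φ M hM u (f.sub hu)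

theorem γ_col_ne_ι {x : V} (hx : x ∈ S) (hxI : x ∉ I) : g.γ (g.col x) ≠ f.ι := by
  rcases g.γ_col_cases hx hxI with ⟨h, e⟩ | ⟨e, -⟩ <;> rw [e]
  · exact g.μ_ne_ι (g.merged_mem h)
  · exact φ_ne_ι hx hxI

theorem γ_ne_φ {x : V} (hx : x ∈ S) (hxI : x ∉ I) {t : C} (ht : g.col x ≠ t) :
    g.γ t ≠ f.φ x := by
  rcases g.γ_cases t with ⟨h, e⟩ | ⟨y, hy, hyI, e', e, -⟩ | ⟨-, y, hy, e', e⟩ | ⟨-, e⟩ <;> rw [e]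
  · exact f.μ_ne_φ _ (g.merged_mem h) x hx
  · exact fun h => ht ((g.col_eq_of_color_eq hy hyI hx hxI h).symm.trans e')
  · exact ν_ne_φ_of_mem hy hx hxI
  · exact (φ_ne_ι hx hxI).symm

theorem γ_ne_γ {x : V} (hx : x ∈ S) (hxI : x ∉ I) {t : C} (ht : g.col x ≠ t) :
    g.γ t ≠ g.γ (g.col x) := by
  rcases g.γ_col_cases hx hxI with ⟨h', e'⟩ | ⟨e', -⟩
  · rw [e']
    rcases g.γ_cases t with ⟨h, e⟩ | ⟨y, hy, hyI, -, e, -⟩ | ⟨-, y, hy, -, e⟩ | ⟨-, e⟩ <;> rw [e]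
    · intro hμ
      have := f.μ_inj (g.merged_mem h) (g.merged_mem h') hμ
      exact ht (g.col_eq_of_mem_merged hx hxI (this ▸ g.mem_merged_self hx hxI))
    · exact (f.μ_ne_φ _ (g.merged_mem h') y hy).symm
    · exact (f.μ_ne_ν _ (g.merged_mem h') y (f.sub hy)).symm
    · exact (g.μ_ne_ι (g.merged_mem h')).symm
  · rw [e']; exact g.γ_ne_φ hx hxI ht

theorem γ_injOn : Set.InjOn g.γ (g.col '' S) := by
  rintro _ ⟨x, hx, rfl⟩ _ ⟨y, hy, rfl⟩ h
  by_contra hne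
  have hxS : x ∈ S := hx
  have hyS : y ∈ S := hy
  have key : ∀ z, g.merged (g.col z) ≠ ∅ → ∃ w ∈ S, w ∉ I ∧ g.col w = g.col z := by
    intro z hz
    obtain ⟨i, hi⟩ := Finset.nonempty_iff_ne_empty.2 hz
    obtain ⟨w, hw, hwI, e, -⟩ := g.mem_merged.1 hi
    exact ⟨w, hw, hwI, e⟩
  by_cases h1 : g.merged (g.col x) = ∅
  · by_cases h2 : g.merged (g.col y) = ∅
    · rcases g.γ_cases (g.col x) with ⟨h3, -⟩ | ⟨w, hw, hwI, e, -⟩ | ⟨-, w, hw, e1, e2⟩ | ⟨h3, -⟩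
      · simp [h1] at h3
      · have := g.mem_merged_self hw hwI
        simp [e, h1] at this
      · rcases g.γ_cases (g.col y) with ⟨h3, -⟩ | ⟨w, hw, hwI, e, -⟩ | ⟨-, z, hz, e3, e4⟩ | ⟨h3, -⟩
        · simp [h2] at h3
        · have := g.mem_merged_self hw hwI
          simp [e, h2] at this
        · have := f.ν_inj (f.sub hw) (f.sub hz) (e2.symm.trans (h.trans e4))
          exact hne (e1.symm.trans (this ▸ e3))
        · exact h3 y hyS rfl
      · exact h3 x hxS rfl
    · obtain ⟨w, hw, hwI, e⟩ := key y h2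
      exact g.γ_ne_γ hw hwI (e ▸ Ne.symm hne) (e ▸ h)
  · obtain ⟨w, hw, hwI, e⟩ := key x h1
    exact g.γ_ne_γ hw hwI (e ▸ hne) (e ▸ h.symm)

/-- `v` lies on the Kempe chain of `x` for the new colour of `x`. -/
def OnChain (x v : V) : Prop := x ∈ S ∧ x ∉ I ∧ v ∈ f.chain x (g.γ (g.col x))

variable {g}

theorem OnChain.color {x v : V} (h : g.OnChain x v) :
    f.φ v = f.φ x ∨ f.φ v = g.γ (g.col x) :=
  (KempeFrame.twoColored_of_mem_chain h.1 h.2.2).2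

/-- Equal targets force equal colours under `g`; two different classes would then be a touching pair
inside a merged set. -/
theorem color_eq_of_γ_eq {x y u v : V} (hu : g.OnChain x u) (hv : g.OnChain y v)
    (h : g.γ (g.col x) = g.γ (g.col y)) (huv : u = v ∨ G.Adj u v) : f.φ x = f.φ y := by
  have hc : g.col x = g.col y := by
    by_contra hne
    exact g.γ_ne_γ hv.1 hv.2.1 (Ne.symm hne) h
  have hy := g.mem_merged_self hv.1 hv.2.1
  rw [← hc] at hy
  rcases g.γ_col_cases hu.1 hu.2.1 with ⟨h', e⟩ | ⟨-, e⟩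
  · by_contra hne
    refine g.merged_not_touched h' ⟨(x, y), hu.1, hu.2.1, hv.1, hv.2.1,
      g.mem_merged_self hu.1 hu.2.1, hy, hne, u, v, e ▸ hu.2.2, ?_, huv⟩
    rw [← e, h]
    exact hv.2.2
  · exact (e _ hy).symm

theorem OnChain.disjoint {x y u v : V} (hu : g.OnChain x u) (hv : g.OnChain y v)
    (hne : f.φ x ≠ f.φ y) (huv : u = v ∨ G.Adj u v) {a b : C}
    (ha : a = f.φ x ∨ a = g.γ (g.col x)) (hb : b = f.φ y ∨ b = g.γ (g.col y)) : a ≠ b := by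
  have hγ : g.γ (g.col x) ≠ g.γ (g.col y) := fun h => hne (color_eq_of_γ_eq hu hv h huv)
  have hc : g.col x ≠ g.col y := fun h => hγ (by rw [h])
  rcases ha with rfl | rfl <;> rcases hb with rfl | rfl
  · exact hne
  · exact (g.γ_ne_φ hu.1 hu.2.1 hc).symm
  · exact g.γ_ne_φ hv.1 hv.2.1 hc.symm
  · exact hγ

theorem OnChain.unique {x y v : V} (hx : g.OnChain x v) (hy : g.OnChain y v) :
    f.φ x = f.φ y := by
  by_contra hne
  exact hx.disjoint hy hne (Or.inl rfl) hx.color hy.color rfl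

variable (g)

open Classical in
/-- The colouring `φ` after recolouring the classes of `S \ I` by Kempe changes. -/
noncomputable def switched (v : V) : C :=
  if h : ∃ x, g.OnChain x v then Equiv.swap (f.φ h.choose) (g.γ (g.col h.choose)) (f.φ v)
  else f.φ v

variable {g}

open Classical in
theorem OnChain.switched_eq {x v : V} (h : g.OnChain x v) :
    g.switched v = Equiv.swap (f.φ x) (g.γ (g.col x)) (f.φ v) := by
  have h' : ∃ x, g.OnChain x v := ⟨x, h⟩
  have e := h'.choose_spec.unique h
  rw [switched, dif_pos h', e,
    g.col_eq_of_color_eq h'.choose_spec.1 h'.choose_spec.2.1 h.1 h.2.1 e]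

theorem OnChain.switched_mem {x v : V} (h : g.OnChain x v) :
    g.switched v = f.φ x ∨ g.switched v = g.γ (g.col x) := by
  classical
  rw [h.switched_eq]
  exact swap_mem_pair h.color

theorem switched_of_not {v : V} (h : ¬ ∃ x, g.OnChain x v) : g.switched v = f.φ v := dif_neg h

/-- A chain absorbs all neighbours of its two colours. Chains of one class undergo the same swap,
and by `OnChain.disjoint` meeting or adjacent chains of different classes share no colours. -/
theorem switched_proper : ProperOff G R g.switched := by
  classical
  have key : ∀ ⦃u w⦄, u ∉ R → w ∉ R → G.Adj u w → (∃ x, g.OnChain x u) →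
      ¬ (∃ x, g.OnChain x w) → g.switched u ≠ g.switched w := by
    rintro u w - hw huw ⟨x, hx⟩ hn e
    rw [switched_of_not hn] at e
    refine hn ⟨x, hx.1, hx.2.1, Linked.tail hx.2.2 huw ⟨hw, ?_⟩⟩
    rw [← e]
    exact hx.switched_mem
  intro u w hu hw huw
  by_cases h1 : ∃ x, g.OnChain x u <;> by_cases h2 : ∃ x, g.OnChain x w
  · obtain ⟨x, hx⟩ := h1
    obtain ⟨y, hy⟩ := h2
    by_cases hxy : f.φ x = f.φ y
    · rw [hx.switched_eq, hy.switched_eq, hxy, g.col_eq_of_color_eq hx.1 hx.2.1 hy.1 hy.2.1 hxy]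
      exact fun e => f.proper hu hw huw ((Equiv.swap _ _).injective e)
    · exact hx.disjoint hy hxy (Or.inr huw) hx.switched_mem hy.switched_mem
  · exact key hu hw huw h1 h2
  · exact (key hw hu huw.symm h2 h1).symm
  · rw [switched_of_not h1, switched_of_not h2]
    exact f.proper hu hw huw

theorem switched_of_notMem {x : V} (hx : x ∈ S) (hxI : x ∉ I) :
    g.switched x = g.γ (g.col x) := by
  classical
  have : g.OnChain x x := ⟨hx, hxI, f.self_mem_chain _ _⟩
  rw [this.switched_eq, Equiv.swap_apply_left]

theorem switched_of_mem {x : V} (hx : x ∈ I) : g.switched x = f.ι := by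
  rw [switched_of_not, φ_of_mem hx]
  rintro ⟨y, hy⟩
  rcases hy.color with e | e <;> rw [φ_of_mem hx] at e
  · exact φ_ne_ι hy.1 hy.2.1 e.symm
  · exact g.γ_col_ne_ι hy.1 hy.2.1 e.symm

theorem OnChain.color_eq_of_bag {y v : V} {i : C} (h : g.OnChain y v) (hb : f.Bag i v) :
    f.φ y = i := by
  rcases h.color with e | e
  · exact hb.color_eq h.1 e
  rcases g.γ_col_cases h.1 h.2.1 with ⟨h', e'⟩ | ⟨e', -⟩
  · have hM := g.merged_mem h'
    rw [e'] at e
    obtain ⟨x, hx, -, rfl⟩ := hb.color_mem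
    rcases hb.color with a | ⟨w, hw, -, -, a⟩ | ⟨M, hM', ht, a, -⟩
    · exact absurd (e.symm.trans a) (f.μ_ne_φ _ hM x hx)
    · exact absurd (e.symm.trans a) (f.μ_ne_ν _ hM w hw)
    · exact absurd (f.μ_inj hM hM' (e.symm.trans a) ▸ ht) (g.merged_not_touched h')
  · exact hb.color_eq h.1 (e.trans e')

/-- Outside the bags, a vertex of colour `t` under `g` will have `ι` and `γ t` exchanged. This shows
that its neighbours in bags use neither colour. -/
theorem switched_ne_of_bag {v : V} {i t : C} (hb : f.Bag i v) (ht : g.col v ≠ t) :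
    g.switched v ≠ f.ι ∧ g.switched v ≠ g.γ t := by
  obtain ⟨u₀, hu₀⟩ := g.nonempty
  have hcol : ∀ x ∈ S, x ∉ I → f.φ x = i → g.col x ≠ t := fun x hx hxI e =>
    g.eq_of_reachable _ _ (hb.reachable hx hxI e) ▸ ht
  by_cases hD : ∃ y, g.OnChain y v
  · obtain ⟨y, hy⟩ := hD
    have hc := hcol y hy.1 hy.2.1 (hy.color_eq_of_bag hb)
    rcases hy.switched_mem with e | e <;> rw [e]
    · exact ⟨φ_ne_ι hy.1 hy.2.1, (g.γ_ne_φ hy.1 hy.2.1 hc).symm⟩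
    · exact ⟨g.γ_col_ne_ι hy.1 hy.2.1, (g.γ_ne_γ hy.1 hy.2.1 hc).symm⟩
  · rw [switched_of_not hD]
    refine ⟨hb.ne_ι hu₀, ?_⟩
    obtain ⟨x, hx, hxI, hxi⟩ := hb.color_mem
    rcases hb.color with a | ⟨w, hw, hwI, hwi, a⟩ | ⟨M, hM', ht', a, -⟩
    · rw [a, ← hxi]
      exact (g.γ_ne_φ hx hxI (hcol x hx hxI hxi)).symm
    · rw [a]
      rcases g.γ_cases t with ⟨h, e⟩ | ⟨y, hy, hyI, e', e, -⟩ | ⟨-, y, hy, e', e⟩ | ⟨-, e⟩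
      · rw [e]; exact (f.μ_ne_ν _ (g.merged_mem h) w hw).symm
      · rw [e]
        intro h
        have h' := h.symm.trans (f.ν_eq w hw y hy h)
        exact hcol y hy hyI (h'.trans hwi) e'
      · rw [e]
        intro h
        exact hwI (f.ν_inj hw (f.sub hy) h ▸ hy)
      · rw [e, ← a]; exact hb.ne_ι hu₀
    · rw [a]
      rcases g.γ_cases t with ⟨h, e⟩ | ⟨y, hy, hyI, e', e, -⟩ | ⟨-, y, hy, e', e⟩ | ⟨-, e⟩ <;>
        rw [e]
      · intro h'
        exact g.merged_not_touched h (f.μ_inj hM' (g.merged_mem h) h' ▸ ht')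
      · exact f.μ_ne_φ _ hM' y hy
      · exact f.μ_ne_ν _ hM' y (f.sub hy)
      · exact g.μ_ne_ι hM'

variable (g)

open Classical in
/-- The final colouring off `R`. -/
noncomputable def recolored (v : V) : C :=
  if ∃ i, f.Bag i v then g.switched v else Equiv.swap f.ι (g.γ (g.col v)) (g.switched v)

/-- Vertices of `S \ I` reach their target by the Kempe switch. Vertices of `I` lie in no bag and
still have colour `ι`, so the final swap sends them to theirs; this is how `I` gets split as `g`
demands. -/
theorem recolored_eq {x : V} (hx : x ∈ S) : g.recolored x = g.γ (g.col x) := by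
  classical
  obtain ⟨u₀, hu₀⟩ := g.nonempty
  by_cases hxI : x ∈ I
  · rw [recolored, if_neg, switched_of_mem hxI, Equiv.swap_apply_left]
    rintro ⟨i, hi⟩
    exact hi.ne_ι hu₀ (φ_of_mem hxI)
  · rw [recolored, if_pos ⟨_, KempeFrame.bag_self hx hxI⟩, switched_of_notMem hx hxI]

/-- An edge off `R` with both ends outside the bags is contracted, so both ends undergo the same
swap. -/
theorem recolored_proper : ProperOff G R g.recolored := by
  classical
  have key : ∀ ⦃u w⦄, u ∉ R → w ∉ R → G.Adj u w → ¬ (∃ i, f.Bag i u) →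
      (∃ i, f.Bag i w) → g.recolored u ≠ g.recolored w := by
    rintro u w hu hw huw hn ⟨i, hi⟩ e
    rw [recolored, if_neg hn, recolored, if_pos ⟨i, hi⟩] at e
    have hcol : g.col w ≠ g.col u := by
      refine (g.ne_of_adj _ _ huw fun hr => hn ⟨i, ?_⟩).symm
      exact (KempeFrame.bag_iff_of_reachable hr i).2 hi
    obtain ⟨h1, h2⟩ := switched_ne_of_bag hi hcol
    rw [Equiv.swap_apply_eq_iff, Equiv.swap_apply_of_ne_of_ne h1 h2] at e
    exact switched_proper hu hw huw e
  intro u w hu hw huw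
  by_cases h1 : ∃ i, f.Bag i u <;> by_cases h2 : ∃ i, f.Bag i w
  · rw [recolored, if_pos h1, recolored, if_pos h2]
    exact switched_proper hu hw huw
  · exact (key hw hu huw.symm h2 h1).symm
  · exact key hu hw huw h1 h2
  · have : f.contracted.Adj u w := ⟨huw, hu, hw, fun i =>
      iff_of_false (fun h => h1 ⟨i, h⟩) (fun h => h2 ⟨i, h⟩)⟩
    rw [recolored, if_neg h1, recolored, if_neg h2, g.eq_of_reachable _ _ this.reachable]
    exact fun e => switched_proper hu hw huw ((Equiv.swap _ _).injective e)

end FrameColoring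

/-! ### Gluing along the separator -/

open Classical in
/-- Colourings of the two sides of a separation that induce the same partition of the separator
can be glued. -/
theorem colorable_of_glue {V : Type u} {G : SimpleGraph V} {S : Finset V} {R : Set V} {C : Type v}
    [Fintype C] (hsep : ∀ u v, u ∈ R → v ∉ R → G.Adj u v → v ∈ S)
    {χ ψ : V → C} (hχ : ProperOff G R χ)
    (hψ : ∀ u v, u ∈ R ∨ u ∈ S → v ∈ R → G.Adj u v → ψ u ≠ ψ v)
    (hS : ∀ x ∈ S, ∀ y ∈ S, χ x = χ y ↔ ψ x = ψ y) : Nonempty (G.Coloring C) := by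
  obtain ⟨γ, hγ⟩ : ∃ γ : C → C, ∀ x ∈ S, γ (ψ x) = χ x := by
    refine ⟨fun t => if h : ∃ x ∈ S, ψ x = t then χ h.choose else t, fun x hx => ?_⟩
    have h : ∃ y ∈ S, ψ y = ψ x := ⟨x, hx, rfl⟩
    beta_reduce
    rw [dif_pos h]
    exact (hS _ h.choose_spec.1 _ hx).2 h.choose_spec.2
  have hinj : Set.InjOn γ (S.image ψ : Finset C) := by
    intro a ha b hb hab
    simp only [Finset.coe_image, Set.mem_image, Finset.mem_coe] at ha hb
    obtain ⟨x, hx, rfl⟩ := ha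
    obtain ⟨y, hy, rfl⟩ := hb
    rw [hγ x hx, hγ y hy] at hab
    exact (hS x hx y hy).1 hab
  obtain ⟨π, hπ⟩ := Finset.exists_equiv_extend_of_card_eq (t := (Finset.univ : Finset C))
    (by simp) (s := S.image ψ) (f := γ) (Finset.subset_univ _) hinj
  have hπS : ∀ x ∈ S, (π (ψ x) : C) = χ x := fun x hx => by
    rw [hπ _ (Finset.mem_image_of_mem _ hx), hγ x hx]
  have hcross : ∀ u w, u ∈ R → w ∉ R → G.Adj u w → (π (ψ u) : C) ≠ χ w := by
    intro u w hu hw huw e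
    have hwS := hsep u w hu hw huw
    rw [← hπS w hwS] at e
    exact hψ w u (Or.inr hwS) hu huw.symm (π.injective (Subtype.ext e)).symm
  refine ⟨SimpleGraph.Coloring.mk (fun v => if v ∈ R then (π (ψ v) : C) else χ v) ?_⟩
  intro u w huw
  split_ifs with h1 h2 h2
  · exact fun e => hψ u w (Or.inl h1) h2 huw (π.injective (Subtype.ext e))
  · exact hcross u w h1 h2 huw
  · exact (hcross w u h2 h1 huw.symm).symm
  · exact hχ h1 h2 huw

theorem FrameColoring.colorable {V : Type u} {G : SimpleGraph V} {S I : Finset V} {R : Set V}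
    {C : Type v} [Fintype C] {f : KempeFrame G S I R C} (g : FrameColoring f)
    (hsep : ∀ u v, u ∈ R → v ∉ R → G.Adj u v → v ∈ S) : Nonempty (G.Coloring C) := by
  refine colorable_of_glue hsep g.recolored_proper (ψ := g.col) ?_ ?_
  · intro u v _ hv huv
    refine g.ne_of_adj u v huv fun hr => ?_
    obtain ⟨p⟩ := hr.symm
    cases p with
    | nil => exact huv.ne rfl
    | cons h _ => exact h.2.1 hv
  · intro x hx y hy
    rw [g.recolored_eq hx, g.recolored_eq hy]
    exact ⟨fun h => g.γ_injOn ⟨x, hx, rfl⟩ ⟨y, hy, rfl⟩ h, fun h => by rw [h]⟩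

end ContractionCritical

/-! ### Critical graphs -/

namespace ContractionCritical

variable {V : Type u} {G : SimpleGraph V} {C : Type v}

theorem ProperOff.mono {R R' : Set V} {φ : V → C} (h : ProperOff G R φ) (hR : R ⊆ R') :
    ProperOff G R' φ := fun _ _ hu hw => h (fun h' => hu (hR h')) (fun h' => hw (hR h'))

/-- `G` cannot be coloured with the colours in `C`, but every graph obtained by contracting edges
and every graph obtained by deleting a vertex can. -/
structure Critical (G : SimpleGraph V) (C : Type v) : Prop where
  not_colorable : ¬ Nonempty (G.Coloring C)
  contract : ∀ F ≤ G, F ≠ ⊥ → ∃ col : V → C, (∀ u v, F.Reachable u v → col u = col v) ∧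
    ∀ u v, G.Adj u v → ¬ F.Reachable u v → col u ≠ col v
  delete : ∀ v, ∃ col : V → C, ProperOff G {v} col

section Minor

theorem exists_coloring_of_minor [Finite V] {k : ℕ} (hG : IsContractionCritical k G)
    (G' : G.Subgraph) (F : SimpleGraph G'.verts) (hF : F ≤ G'.coe)
    (hcard : Nat.card F.ConnectedComponent < Nat.card V) :
    ∃ col : G'.verts → Fin (k - 1), (∀ u v, F.Reachable u v → col u = col v) ∧
      ∀ u v, G'.coe.Adj u v → ¬ F.Reachable u v → col u ≠ col v := by
  obtain ⟨ψ⟩ := hG.2 F.ConnectedComponent (ContractionCritical.contract G'.coe F)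
    ⟨⟨G', F, hF, ⟨SimpleGraph.Iso.refl⟩⟩, ⟨fun e => hcard.ne (Nat.card_congr e.toEquiv)⟩⟩
  refine ⟨fun v => ψ (F.connectedComponentMk v), fun u v h => ?_, fun u v huv h => ?_⟩
  · exact congrArg ψ (SimpleGraph.ConnectedComponent.eq.2 h)
  · exact ψ.valid ⟨fun e => h (SimpleGraph.ConnectedComponent.eq.1 e), u, v, rfl, rfl, huv⟩

theorem IsContractionCritical.critical [Finite V] {k : ℕ} (hk : 2 ≤ k)
    (hG : IsContractionCritical k G) : Critical G (Fin (k - 1)) where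
  not_colorable := by
    intro h
    have : G.Colorable (k - 1) := h
    have := this.chromaticNumber_le
    rw [hG.1, Nat.cast_le] at this
    omega
  contract := by
    intro F hF hne
    let T : G.Subgraph := ⊤
    let i : V → T.verts := fun v => ⟨v, trivial⟩
    let F' : SimpleGraph T.verts := F.comap Subtype.val
    have hr : ∀ u v, F'.Reachable (i u) (i v) ↔ F.Reachable u v := fun u v =>
      ⟨fun h => h.map (⟨Subtype.val, fun h => h⟩ : F' →g F),
        fun h => h.map (⟨i, fun h => h⟩ : F →g F')⟩
    obtain ⟨a, b, hab⟩ := SimpleGraph.ne_bot_iff_exists_adj.1 hne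
    have hsurj : Function.Surjective fun v => F'.connectedComponentMk (i v) := by
      intro c
      obtain ⟨v, rfl⟩ := c.exists_rep
      exact ⟨v.1, rfl⟩
    have hninj : ¬ Function.Injective fun v => F'.connectedComponentMk (i v) := fun h =>
      hab.ne (h (SimpleGraph.ConnectedComponent.eq.2 ((hr a b).2 hab.reachable)))
    have hcard : Nat.card F'.ConnectedComponent < Nat.card V := by
      have := Fintype.ofFinite V
      have := Fintype.ofFinite F'.ConnectedComponent
      rw [Nat.card_eq_fintype_card, Nat.card_eq_fintype_card]
      exact Fintype.card_lt_of_surjective_not_injective _ hsurj hninj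
    obtain ⟨col, h1, h2⟩ := exists_coloring_of_minor hG T F' (fun u v h => hF h) hcard
    exact ⟨fun v => col (i v), fun u v h => h1 _ _ ((hr u v).2 h),
      fun u v huv h => h2 _ _ huv fun h' => h ((hr u v).1 h')⟩
  delete := by
    intro v
    classical
    let T : G.Subgraph := (⊤ : G.Subgraph).deleteVerts {v}
    have hcard : Nat.card (⊥ : SimpleGraph T.verts).ConnectedComponent < Nat.card V := by
      refine lt_of_le_of_lt (Nat.card_le_card_of_surjective
        (⊥ : SimpleGraph T.verts).connectedComponentMk fun c => c.exists_rep) ?_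
      exact Finite.card_subtype_lt (x := v) (p := (· ∈ T.verts)) (by simp [T])
    obtain ⟨col, -, h2⟩ := exists_coloring_of_minor hG T ⊥ bot_le hcard
    have hT : ∀ u, u ≠ v → u ∈ T.verts := fun u hu => by simpa [T] using hu
    refine ⟨fun u => if h : u ≠ v then col ⟨u, hT u h⟩ else ⟨0, by omega⟩, ?_⟩
    intro u w hu hw huw
    have hu' : u ≠ v := hu
    have hw' : w ≠ v := hw
    simp only [dif_pos hu', dif_pos hw']
    refine h2 _ _ ?_ ?_
    · simp [T, hu', hw', huw]
    · rw [SimpleGraph.reachable_bot]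
      exact fun e => huw.ne (congrArg Subtype.val e)

end Minor

/-- Contracting a connected set `K` together with an independent set `I` of neighbours yields a
colouring of `G - K` in which `I` is the trace of a colour class. -/
theorem Critical.exists_class (hG : Critical G C) {S I : Finset V} {K : Set V} {c₀ : V}
    (hc₀ : c₀ ∈ K) (hK : ∀ y ∈ K, Linked G (· ∈ K) c₀ y) (hSK : ∀ x ∈ S, x ∉ K)
    (hadj : ∀ x ∈ S, ∃ y ∈ K, G.Adj x y) (hI : I ⊆ S) (hne : I.Nonempty)
    (hind : ∀ x ∈ I, ∀ y ∈ I, ¬ G.Adj x y) :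
    ∃ (φ : V → C) (ι : C), ProperOff G K φ ∧ ∀ x ∈ S, φ x = ι ↔ x ∈ I := by
  -- This contracts `K ∪ I` to one vertex, adjacent to every vertex of `S \ I`; hence its colour
  -- occurs on `S` exactly at `I`.
  let F : SimpleGraph V :=
    { Adj := fun u v => G.Adj u v ∧ (u ∈ K ∨ u ∈ I) ∧ (v ∈ K ∨ v ∈ I)
      symm := ⟨fun _ _ h => ⟨h.1.symm, h.2.2, h.2.1⟩⟩
      loopless := ⟨fun _ h => h.1.ne rfl⟩ }
  have hreach : ∀ u v, F.Reachable u v → u ≠ v → (u ∈ K ∨ u ∈ I) ∧ (v ∈ K ∨ v ∈ I) := by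
    have key : ∀ u v, F.Reachable u v → u ≠ v → (u ∈ K ∨ u ∈ I) := by
      rintro u v ⟨p⟩ hne
      cases p with
      | nil => exact absurd rfl hne
      | cons h _ => exact h.2.1
    exact fun u v h hne => ⟨key u v h hne, key v u h.symm hne.symm⟩
  have hKr : ∀ y ∈ K, F.Reachable c₀ y := fun y hy =>
    (hK y hy).reachable fun u w hu hw huw =>
      ⟨huw, Or.inl (hu.pred hc₀), Or.inl (hw.pred hc₀)⟩
  have hIr : ∀ x ∈ I, F.Reachable c₀ x := fun x hx => by
    obtain ⟨y, hy, hxy⟩ := hadj x (hI hx)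
    have : F.Adj y x := ⟨hxy.symm, Or.inl hy, Or.inr hx⟩
    exact (hKr y hy).trans this.reachable
  have hFne : F ≠ ⊥ := by
    intro hbot
    obtain ⟨x, hx⟩ := hne
    have := hIr x hx
    rw [hbot, SimpleGraph.reachable_bot] at this
    exact hSK x (hI hx) (this ▸ hc₀)
  obtain ⟨col, h1, h2⟩ := hG.contract F (fun _ _ h => h.1) hFne
  refine ⟨col, col c₀, fun u v hu hv huv => h2 u v huv fun hr => ?_, fun x hx => ⟨fun e => ?_,
    fun hxI => (h1 _ _ (hIr x hxI)).symm⟩⟩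
  · obtain ⟨h3, h4⟩ := hreach u v hr huv.ne
    exact hind u (h3.resolve_left hu) v (h4.resolve_left hv) huv
  · by_contra hxI
    obtain ⟨y, hy, hxy⟩ := hadj x hx
    refine h2 x y hxy (fun hr => ?_) (e.trans (h1 _ _ (hKr y hy)))
    exact (hreach x y hr hxy.ne).1.elim (hSK x hx) hxI

/-! ### Counting private colours -/

section Counting

open Classical in
theorem card_filter_two_le_powerset {α : Type*} (J : Finset α) :
    (J.powerset.filter (2 ≤ ·.card)).card + J.card + 1 ≤ 2 ^ J.card := by
  have h1 : Disjoint (J.powerset.filter (2 ≤ ·.card)) (insert ∅ (J.image fun i => {i})) := by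
    rw [Finset.disjoint_left]
    intro M hM hM'
    have h2 := (Finset.mem_filter.1 hM).2
    rcases Finset.mem_insert.1 hM' with rfl | h
    · simp at h2
    · obtain ⟨i, -, rfl⟩ := Finset.mem_image.1 h
      simp at h2
  have h2 : (insert ∅ (J.image fun i => ({i} : Finset α))).card = J.card + 1 := by
    rw [Finset.card_insert_of_notMem, Finset.card_image_of_injective _ Finset.singleton_injective]
    simp
  have h3 : J.powerset.filter (2 ≤ ·.card) ∪ insert ∅ (J.image fun i => {i}) ⊆ J.powerset := by
    intro M hM
    rcases Finset.mem_union.1 hM with h | h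
    · exact (Finset.mem_filter.1 h).1
    · rcases Finset.mem_insert.1 h with rfl | h
      · exact Finset.empty_mem_powerset _
      · obtain ⟨i, hi, rfl⟩ := Finset.mem_image.1 h
        simpa using hi
  have := Finset.card_le_card h3
  rw [Finset.card_union_of_disjoint h1, h2, Finset.card_powerset] at this
  omega

theorem two_pow_add_le (a d : ℕ) : 2 ^ a + d ≤ 2 ^ (a + d) := by
  induction d with
  | zero => simp
  | succ d ih =>
    rw [← add_assoc, ← add_assoc, pow_succ]
    have := Nat.one_le_two_pow (n := a + d)
    omega

/-- The sum is at most `s + 2 ^ |J| - |J| - 1`, which is largest for `|J| = s - 4`. This gives `2 ^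
(s - 4) + 3 ≤ 2 ^ (t - 5) + 3`, at most `2 ^ (t - 4) + 1` because `t ≥ 6`. -/
theorem add_card_filter_le {α : Type*} {J : Finset α} {s t c : ℕ} (hJ : J.card + 4 ≤ s)
    (hst : s + 1 ≤ t) (ht : 6 ≤ t) (hc : 2 ^ (t - 4) + 1 ≤ c) :
    s + (J.powerset.filter (2 ≤ ·.card)).card ≤ c := by
  classical
  have h1 := card_filter_two_le_powerset J
  obtain ⟨d, rfl⟩ := Nat.exists_eq_add_of_le hJ
  have h2 := two_pow_add_le J.card d
  have h3 : 2 ^ (J.card + d + 1) ≤ 2 ^ (t - 4) := Nat.pow_le_pow_right (by norm_num) (by omega)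
  have h4 : 2 ^ 2 ≤ 2 ^ (t - 4) := Nat.pow_le_pow_right (by norm_num) (by omega)
  rw [pow_succ] at h3
  have h5 := two_pow_add_le 0 (J.card + d)
  rw [zero_add] at h5
  by_cases h : J.card + d = 0
  · obtain ⟨hj, hd⟩ := Nat.add_eq_zero_iff.1 h
    have h6 : 2 ^ J.card = 1 := by rw [hj]; rfl
    omega
  · have h7 : 2 ≤ 2 ^ (J.card + d) := by omega
    omega

open Classical in
/-- The sets of at least two colour classes that may become one class after contraction all live in
a small set of colours. -/
theorem exists_small_colors {S I : Finset V} (hIS : I ⊆ S) (φ : V → C)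
    (hninj : ¬ Set.InjOn φ (S \ I : Finset V))
    (hI : 3 ≤ I.card ∨ (2 ≤ I.card ∧ ∀ x ∈ S, ∀ y ∈ S, ∀ z ∈ S, x ≠ y → x ≠ z → y ≠ z →
      G.Adj x y ∨ G.Adj x z ∨ G.Adj y z)) :
    ∃ J : Finset C, J.card + 4 ≤ S.card ∧
      ∀ T ⊆ S, (∀ x ∈ T, x ∉ I) → (∀ x ∈ T, ∀ y ∈ T, ¬ G.Adj x y) →
        (∀ x ∈ T, ∀ y ∈ S, y ∉ I → φ x = φ y → y ∈ T) →
        ∀ M : Finset C, 2 ≤ M.card → (∀ i, i ∈ M ↔ ∃ x ∈ T, φ x = i) → M ⊆ J := by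
  have hcard := Finset.card_sdiff_add_card_eq_card hIS
  simp only [Set.InjOn, Finset.mem_coe] at hninj
  push Not at hninj
  obtain ⟨x, hx, y, hy, hxy, hne⟩ := hninj
  rcases hI with hI | ⟨hI, htri⟩
  · refine ⟨(S \ I).image φ, ?_, ?_⟩
    · have h1 : (S \ I).image φ ⊆ ((S \ I).erase x).image φ := by
        intro i hi
        obtain ⟨z, hz, rfl⟩ := Finset.mem_image.1 hi
        by_cases hzx : z = x
        · exact Finset.mem_image.2 ⟨y, Finset.mem_erase.2 ⟨hne.symm, hy⟩, by rw [hzx, hxy]⟩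
        · exact Finset.mem_image_of_mem _ (Finset.mem_erase.2 ⟨hzx, hz⟩)
      have h2 := (Finset.card_le_card h1).trans Finset.card_image_le
      rw [Finset.card_erase_of_mem hx] at h2
      have := Finset.card_pos.2 ⟨x, hx⟩
      omega
    · intro T hT hTI _ _ M _ hMT i hi
      obtain ⟨z, hz, rfl⟩ := (hMT i).1 hi
      exact Finset.mem_image_of_mem _ (Finset.mem_sdiff.2 ⟨hT hz, hTI z hz⟩)
  · let D := (S \ I).filter fun x => ∀ y ∈ S \ I, φ x = φ y → x = y
    refine ⟨D.image φ, ?_, ?_⟩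
    · have h1 : D ⊆ ((S \ I).erase x).erase y := by
        intro z hz
        obtain ⟨hz, hz'⟩ := Finset.mem_filter.1 hz
        refine Finset.mem_erase.2 ⟨?_, Finset.mem_erase.2 ⟨?_, hz⟩⟩
        · rintro rfl; exact hne (hz' x hx hxy.symm).symm
        · rintro rfl; exact hne (hz' y hy hxy)
      have h2 := (Finset.card_image_le (f := φ)).trans (Finset.card_le_card h1)
      have h3 : y ∈ (S \ I).erase x := Finset.mem_erase.2 ⟨hne.symm, hy⟩
      have h4 := Finset.card_pos.2 ⟨y, h3⟩
      rw [Finset.card_erase_of_mem h3] at h2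
      rw [Finset.card_erase_of_mem hx] at h2 h4
      omega
    · intro T hT hTI hind hcl M hM hMT i hi
      obtain ⟨z, hz, rfl⟩ := (hMT i).1 hi
      refine Finset.mem_image.2 ⟨z, Finset.mem_filter.2
        ⟨Finset.mem_sdiff.2 ⟨hT hz, hTI z hz⟩, fun w hw hzw => ?_⟩, rfl⟩
      by_contra hzw'
      obtain ⟨hwS, hwI⟩ := Finset.mem_sdiff.1 hw
      have hwT := hcl z hz w hwS hwI hzw
      obtain ⟨j, hj, hji⟩ := Finset.exists_mem_ne (by omega : 1 < M.card) (φ z)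
      obtain ⟨r, hr, rfl⟩ := (hMT j).1 hj
      rcases htri z (hT hz) w hwS r (hT hr) hzw' (fun e => hji (by rw [e]))
        (fun e => hji (by rw [← e, hzw])) with h | h | h
      · exact hind _ hz _ hwT h
      · exact hind _ hz _ hr h
      · exact hind _ hwT _ hr h

end Counting

open Classical in
/-- Private colours exist if there are enough colours. -/
theorem exists_private_colors [Fintype C] [Nonempty C] (S : Finset V) (φ : V → C)
    (𝓜 : Finset (Finset C)) (hcard : S.card + 𝓜.card ≤ Fintype.card C) :
    ∃ (ν : V → C) (μ : Finset C → C), Set.InjOn ν S ∧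
      (∀ w ∈ S, ∀ x ∈ S, ν w = φ x → ν w = φ w) ∧ Set.InjOn μ 𝓜 ∧
      (∀ M ∈ 𝓜, ∀ w ∈ S, μ M ≠ ν w) ∧ ∀ M ∈ 𝓜, ∀ w ∈ S, μ M ≠ φ w := by
  -- `T` has one vertex of each colour on `S`, whose private colour is its own. The rest of `S` and
  -- the members of `𝓜` get distinct colours unused on `S`.
  obtain ⟨T, hTS, hinj, himg⟩ := Finset.exists_subset_injOn_image_eq_of_surjOn (f := φ)
    (S : Set V) (S.image φ) (by
      intro i hi
      simpa using hi)
  have hTS' : T ⊆ S := fun x hx => hTS hx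
  let X : Finset (V ⊕ Finset C) := (S \ T).disjSum 𝓜
  let Y : Finset C := Finset.univ \ S.image φ
  have hX : X.card + T.card = S.card + 𝓜.card := by
    rw [Finset.card_disjSum, ← Finset.card_sdiff_add_card_eq_card hTS']
    omega
  have hY : Y.card + T.card = Fintype.card C := by
    rw [← Finset.card_image_of_injOn hinj, himg]
    exact Finset.card_sdiff_add_card_eq_card (Finset.subset_univ _)
  obtain ⟨e⟩ : Nonempty (X ↪ Y) := Function.Embedding.nonempty_of_card_le (by
    rw [Fintype.card_coe, Fintype.card_coe]; omega)
  have heφ : ∀ p, ∀ x ∈ S, (e p : C) ≠ φ x := fun p x hx h =>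
    (Finset.mem_sdiff.1 (e p).2).2 (h ▸ Finset.mem_image_of_mem _ hx)
  have heinj : ∀ p q, (e p : C) = e q → p.1 = q.1 := fun p q h =>
    congrArg _ (e.injective (Subtype.ext h))
  let ν : V → C := fun w => if h : Sum.inl w ∈ X then (e ⟨_, h⟩ : C) else φ w
  let μ : Finset C → C := fun M =>
    if h : Sum.inr M ∈ X then (e ⟨_, h⟩ : C) else Classical.arbitrary C
  have hνT : ∀ w ∈ T, ν w = φ w := fun w hw => dif_neg (by simp [X, hw])
  have hνX : ∀ w ∈ S, w ∉ T → ∃ h : Sum.inl w ∈ X, ν w = e ⟨_, h⟩ := fun w hw hwT =>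
    have h : Sum.inl w ∈ X := by simp [X, hw, hwT]
    ⟨h, dif_pos h⟩
  have hμ : ∀ M ∈ 𝓜, ∃ h : Sum.inr M ∈ X, μ M = e ⟨_, h⟩ := fun M hM =>
    have h : Sum.inr M ∈ X := by simp [X, hM]
    ⟨h, dif_pos h⟩
  refine ⟨ν, μ, ?_, ?_, ?_, ?_, ?_⟩
  · intro w hw x hx h
    have hw' : w ∈ S := hw
    have hx' : x ∈ S := hx
    by_cases h1 : w ∈ T <;> by_cases h2 : x ∈ T
    · rw [hνT w h1, hνT x h2] at h
      exact hinj h1 h2 h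
    · obtain ⟨_, e2⟩ := hνX x hx' h2
      rw [hνT w h1, e2] at h
      exact absurd h.symm (heφ _ w hw')
    · obtain ⟨_, e1⟩ := hνX w hw' h1
      rw [hνT x h2, e1] at h
      exact absurd h (heφ _ x hx')
    · obtain ⟨_, e1⟩ := hνX w hw' h1
      obtain ⟨_, e2⟩ := hνX x hx' h2
      rw [e1, e2] at h
      exact Sum.inl_injective (heinj _ _ h)
  · intro w hw x hx h
    by_cases h1 : w ∈ T
    · exact hνT w h1
    · obtain ⟨_, e1⟩ := hνX w hw h1
      exact absurd (e1.symm.trans h) (heφ _ x hx)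
  · intro M hM N hN h
    obtain ⟨_, e1⟩ := hμ M hM
    obtain ⟨_, e2⟩ := hμ N hN
    rw [e1, e2] at h
    exact Sum.inr_injective (heinj _ _ h)
  · intro M hM w hw h
    obtain ⟨_, e1⟩ := hμ M hM
    by_cases h1 : w ∈ T
    · rw [hνT w h1, e1] at h
      exact heφ _ w hw h
    · obtain ⟨_, e2⟩ := hνX w hw h1
      rw [e1, e2] at h
      exact Sum.inr_ne_inl (heinj _ _ h)
  · intro M hM w hw h
    obtain ⟨_, e1⟩ := hμ M hM
    exact heφ _ w hw (e1.symm.trans h)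

open Classical in
/-- Some colouring off `R` with colour class `I` on `S` is injective on `S \ I`. -/
theorem Critical.exists_injOn [Finite V] [Fintype C] (hG : Critical G C) {S I : Finset V}
    {R : Set V} {ι : C} {t : ℕ} (hSR : ∀ x ∈ S, x ∉ R)
    (hsep : ∀ u v, u ∈ R → v ∉ R → G.Adj u v → v ∈ S)
    (hadj : ∀ x ∈ I, ∃ b, b ∉ R ∧ b ∉ S ∧ G.Adj x b) (hIS : I ⊆ S)
    (hI : 3 ≤ I.card ∨ (2 ≤ I.card ∧ ∀ x ∈ S, ∀ y ∈ S, ∀ z ∈ S, x ≠ y → x ≠ z → y ≠ z →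
      G.Adj x y ∨ G.Adj x z ∨ G.Adj y z))
    (hst : S.card + 1 ≤ t) (ht : 6 ≤ t) (hc : 2 ^ (t - 4) + 1 ≤ Fintype.card C)
    (hex : ∃ φ : V → C, ProperOff G R φ ∧ ∀ x ∈ S, φ x = ι ↔ x ∈ I) :
    ∃ φ : V → C, ProperOff G R φ ∧ (∀ x ∈ S, φ x = ι ↔ x ∈ I) ∧
      Set.InjOn φ (S \ I : Finset V) := by
  obtain ⟨u₀, hu₀⟩ : I.Nonempty := Finset.card_pos.1 (by omega)
  have : Nonempty {φ : V → C // ProperOff G R φ ∧ ∀ x ∈ S, φ x = ι ↔ x ∈ I} :=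
    ⟨⟨_, hex.choose_spec⟩⟩
  obtain ⟨⟨φ, hφ, hι⟩, hmax⟩ := Finite.exists_max
    (fun ψ : {φ : V → C // ProperOff G R φ ∧ ∀ x ∈ S, φ x = ι ↔ x ∈ I} =>
      ((S \ I).image ψ.1).card)
  refine ⟨φ, hφ, hι, ?_⟩
  by_contra hninj
  obtain ⟨J, hJ, hJM⟩ := exists_small_colors (G := G) hIS φ hninj hI
  have : Nonempty C := ⟨ι⟩
  obtain ⟨ν, μ, h1, h2, h3, h4, h5⟩ := exists_private_colors S φ _
    (add_card_filter_le hJ hst ht hc)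
  have hu₀ι : φ u₀ = ι := (hι u₀ (hIS hu₀)).2 hu₀
  let f : KempeFrame G S I R C :=
    { φ := φ, ι := ι, proper := hφ, off := hSR, class_iff := hι, sub := hIS, ν := ν, ν_inj := h1
      ν_eq := h2, 𝓜 := _, μ := μ, μ_inj := h3, μ_ne_ν := h4, μ_ne_φ := h5
      linked := fun x hx y hy hxI hyI hxy hν => linked_of_maximal hSR hφ hι
        (fun ψ hψ hψ' => hmax ⟨ψ, hψ, hψ'⟩) hx hxI hy hyI hxy hν
        (fun e => hν u₀ (hIS hu₀) (e.trans hu₀ι.symm)) }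
  obtain ⟨b, hb, hbS, hub⟩ := hadj u₀ hu₀
  obtain ⟨col, hc1, hc2⟩ := hG.contract f.contracted f.contracted_le
    (KempeFrame.contracted_ne_bot hu₀ hb hbS hub)
  let g : FrameColoring f :=
    { col := col, eq_of_reachable := hc1, ne_of_adj := hc2, nonempty := ⟨u₀, hu₀⟩
      mem_of_indep := fun T a1 a2 a3 a4 M a5 a6 => Finset.mem_filter.2
        ⟨Finset.mem_powerset.2 (hJM T a1 a2 a3 a4 M a5 a6), a5⟩ }
  exact hG.not_colorable (g.colorable hsep)

end ContractionCritical

/-! ### Minimal separators -/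

namespace ContractionCritical

variable {V : Type u} {G : SimpleGraph V} {C : Type v}

theorem Linked.mono {P Q : V → Prop} {x y : V} (h : Linked G P x y) (hPQ : ∀ v, P v → Q v) :
    Linked G Q x y :=
  Relation.ReflTransGen.mono (fun _ w h => ⟨h.1, hPQ w h.2⟩) _ _ h

theorem Linked.symm {P : V → Prop} {x y : V} (h : Linked G P x y) (hx : P x) :
    Linked G P y x := by
  induction h with
  | refl => exact Linked.refl _ _
  | @tail b c hb hbc ih => exact Relation.ReflTransGen.head ⟨hbc.1.symm, Linked.pred hb hx⟩ ih

theorem Linked.linked_linked {P : V → Prop} {x y : V} (h : Linked G P x y) :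
    Linked G (Linked G P x) x y := by
  induction h with
  | refl => exact Linked.refl _ _
  | @tail b c hb hbc ih => exact ih.tail hbc.1 (Linked.tail hb hbc.1 hbc.2)

theorem color_eq_iff_of_injOn [DecidableEq V] {S I : Finset V} {φ : V → C} {ι : C}
    (hι : ∀ x ∈ S, φ x = ι ↔ x ∈ I) (hinj : Set.InjOn φ (S \ I : Finset V)) {x y : V} (hx : x ∈ S)
    (hy : y ∈ S) : φ x = φ y ↔ x = y ∨ (x ∈ I ∧ y ∈ I) := by
  constructor
  · intro e
    by_cases hxI : x ∈ I
    · exact Or.inr ⟨hxI, (hι y hy).1 (e.symm.trans ((hι x hx).2 hxI))⟩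
    by_cases hyI : y ∈ I
    · exact Or.inr ⟨(hι x hx).1 (e.trans ((hι y hy).2 hyI)), hyI⟩
    exact Or.inl (hinj (by simp [hx, hxI]) (by simp [hy, hyI]) e)
  · rintro (rfl | ⟨hxI, hyI⟩)
    · rfl
    · rw [(hι x hx).2 hxI, (hι y hy).2 hyI]

open Classical in
/-- A nonclique `S` contains an independent triple or, if there is none, a nonadjacent pair. -/
theorem exists_indep {S : Finset V} {x y : V} (hx : x ∈ S) (hy : y ∈ S) (hxy : x ≠ y)
    (h : ¬ G.Adj x y) : ∃ I ⊆ S, (∀ u ∈ I, ∀ w ∈ I, ¬ G.Adj u w) ∧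
      (3 ≤ I.card ∨ (2 ≤ I.card ∧ ∀ x ∈ S, ∀ y ∈ S, ∀ z ∈ S, x ≠ y → x ≠ z → y ≠ z →
        G.Adj x y ∨ G.Adj x z ∨ G.Adj y z)) := by
  by_cases ht : ∃ x ∈ S, ∃ y ∈ S, ∃ z ∈ S, x ≠ y ∧ x ≠ z ∧ y ≠ z ∧
      ¬ G.Adj x y ∧ ¬ G.Adj x z ∧ ¬ G.Adj y z
  · obtain ⟨x, hx, y, hy, z, hz, h1, h2, h3, h4, h5, h6⟩ := ht
    refine ⟨{x, y, z}, ?_, ?_, Or.inl ?_⟩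
    · simp [Finset.insert_subset_iff, hx, hy, hz]
    · simp [h4, h5, h6, G.adj_comm y x, G.adj_comm z x, G.adj_comm z y]
    · rw [Finset.card_eq_three.2 ⟨x, y, z, h1, h2, h3, rfl⟩]
  · refine ⟨{x, y}, ?_, ?_, Or.inr ⟨?_, ?_⟩⟩
    · simp [Finset.insert_subset_iff, hx, hy]
    · simp [h, G.adj_comm y x]
    · rw [Finset.card_pair hxy]
    · intro x hx y hy z hz h1 h2 h3
      by_contra hn
      push Not at hn
      exact ht ⟨x, hx, y, hy, z, hz, h1, h2, h3, hn⟩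

open Classical in
/-- A minimal separator of a critical graph is large. -/
theorem Critical.false_of_minimal_separator [Finite V] [Fintype C] (hG : Critical G C)
    {S : Finset V} {t : ℕ} (hst : S.card + 1 ≤ t) (ht : 6 ≤ t)
    (hc : 2 ^ (t - 4) + 1 ≤ Fintype.card C) {a b : V} (ha : a ∉ S) (hb : b ∉ S)
    (hab : ¬ Linked G (· ∉ S) a b)
    (hA : ∀ x ∈ S, ∃ y, Linked G (· ∉ S) a y ∧ G.Adj x y)
    (hB : ∀ x ∈ S, ∃ y, Linked G (· ∉ S) b y ∧ G.Adj x y) : False := by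
  let A : Set V := {v | Linked G (· ∉ S) a v}
  let B : Set V := {v | Linked G (· ∉ S) b v}
  -- `R` may contain components other than `B`: `B` is the set contracted, and the resulting
  -- colouring is then restricted to the complement of `R`.
  let R : Set V := {v | v ∉ A ∧ v ∉ S}
  have hAS : ∀ v ∈ A, v ∉ S := fun v hv => Linked.pred (P := (· ∉ S)) hv ha
  have hBS : ∀ v ∈ B, v ∉ S := fun v hv => Linked.pred (P := (· ∉ S)) hv hb
  have hBA : ∀ v ∈ B, v ∉ A := fun v hv hv' =>
    hab (Relation.ReflTransGen.trans hv' (Linked.symm hv hb))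
  have hBR : B ⊆ R := fun v hv => ⟨hBA v hv, hBS v hv⟩
  have haA : a ∈ A := Linked.refl _ _
  have hbB : b ∈ B := Linked.refl _ _
  have hsepA : ∀ u v, u ∈ A → v ∉ A → G.Adj u v → v ∈ S := by
    intro u v hu hv huv
    by_contra hvS
    exact hv (Linked.tail hu huv hvS)
  have hsepR : ∀ u v, u ∈ R → v ∉ R → G.Adj u v → v ∈ S := by
    intro u v hu hv huv
    by_contra hvS
    have hvA : v ∈ A := by
      by_contra hvA
      exact hv ⟨hvA, hvS⟩
    exact hu.2 (hsepA v u hvA hu.1 huv.symm)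
  have hSA : ∀ x ∈ S, x ∉ A := fun x hx h => hAS x h hx
  have hSB : ∀ x ∈ S, x ∉ B := fun x hx h => hBS x h hx
  have hSR : ∀ x ∈ S, x ∉ R := fun x hx h => h.2 hx
  have glue : ∀ {χ ψ : V → C}, ProperOff G A χ → ProperOff G R ψ →
      (∀ x ∈ S, ∀ y ∈ S, χ x = χ y ↔ ψ x = ψ y) → False := by
    intro χ ψ hχ hψ h
    refine hG.not_colorable (colorable_of_glue hsepA hχ (fun u v hu hv huv => hψ ?_ ?_ huv) h)
    · exact fun h' => hu.elim h'.1 h'.2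
    · exact fun h' => h'.1 hv
  by_cases hcl : ∀ x ∈ S, ∀ y ∈ S, x ≠ y → G.Adj x y
  · obtain ⟨χ, hχ⟩ := hG.delete a
    obtain ⟨ψ, hψ⟩ := hG.delete b
    have hχ' : ProperOff G A χ := hχ.mono (by simpa using haA)
    have hψ' : ProperOff G R ψ := hψ.mono (by simpa using hBR hbB)
    have key : ∀ {R : Set V} {φ : V → C}, (∀ x ∈ S, x ∉ R) → ProperOff G R φ → ∀ x ∈ S, ∀ y ∈ S,
        (φ x = φ y ↔ x = y) := by
      intro R φ hR hφ x hx y hy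
      refine ⟨fun e => ?_, fun e => e ▸ rfl⟩
      by_contra hne
      exact hφ (hR x hx) (hR y hy) (hcl x hx y hy hne) e
    exact glue hχ' hψ' fun x hx y hy => (key hSA hχ' x hx y hy).trans (key hSR hψ' x hx y hy).symm
  · push Not at hcl
    obtain ⟨x, hx, y, hy, hxy, hnadj⟩ := hcl
    obtain ⟨I, hIS, hind, hI⟩ := exists_indep hx hy hxy hnadj
    have hne : I.Nonempty := Finset.card_pos.1 (by omega)
    obtain ⟨φ₁, ι₁, h1, h2⟩ := hG.exists_class haA (fun y hy => Linked.linked_linked hy) hSA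
      hA hIS hne hind
    obtain ⟨φ₂, ι₂, h3, h4⟩ := hG.exists_class hbB (fun y hy => Linked.linked_linked hy) hSB
      hB hIS hne hind
    obtain ⟨χ, h5, h6, h7⟩ := hG.exists_injOn hSA hsepA (fun x hx => by
      obtain ⟨y, hy, hxy⟩ := hB x (hIS hx)
      exact ⟨y, hBA y hy, hBS y hy, hxy⟩) hIS hI hst ht hc ⟨φ₁, h1, h2⟩
    obtain ⟨ψ, h8, h9, h10⟩ := hG.exists_injOn hSR hsepR (fun x hx => by
      obtain ⟨y, hy, hxy⟩ := hA x (hIS hx)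
      exact ⟨y, fun h => h.1 hy, hAS y hy, hxy⟩) hIS hI hst ht hc ⟨φ₂, h3.mono hBR, h4⟩
    exact glue h5 h8 fun x hx y hy => (color_eq_iff_of_injOn h6 h7 hx hy).trans
      (color_eq_iff_of_injOn h9 h10 hx hy).symm

open Classical in
-- Induction on `|S|` makes a failing `S` minimal: putting back any `x ∈ S` reconnects `a` and `b`,
-- so `x` has neighbours in both components.
theorem Critical.linked [Finite V] [Fintype C] (hG : Critical G C) {t : ℕ} (ht : 6 ≤ t)
    (hc : 2 ^ (t - 4) + 1 ≤ Fintype.card C) {a b : V} (S : Finset V) (hst : S.card + 1 ≤ t)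
    (ha : a ∉ S) (hb : b ∉ S) : Linked G (· ∉ S) a b := by
  induction hn : S.card using Nat.strong_induction_on generalizing S with
  | _ n ih =>
    by_contra hab
    have herase : ∀ x ∈ S, Linked G (· ∉ S.erase x) a b := fun x hx =>
      have hlt := Finset.card_erase_lt_of_mem hx
      ih _ (hn ▸ hlt) (S.erase x) (by omega) (fun h => ha (Finset.mem_of_mem_erase h))
        (fun h => hb (Finset.mem_of_mem_erase h)) rfl
    have key : ∀ c d, ¬ Linked G (· ∉ S) c d → ∀ x ∈ S, Linked G (· ∉ S.erase x) c d →
        ∃ y, Linked G (· ∉ S) c y ∧ G.Adj x y := by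
      intro c d hcd x hx h
      have hP : ∀ v, v ∉ S.erase x ∧ v ∉ ({x} : Set V) → v ∉ S := fun v hv hvS =>
        hv.1 (Finset.mem_erase.2 ⟨hv.2, hvS⟩)
      rcases h.avoid_or_adj (X := {x}) with h | ⟨v, w, h, hw, hvw⟩
      · exact absurd (h.mono hP) hcd
      · obtain rfl : w = x := hw
        exact ⟨v, h.mono hP, hvw.symm⟩
    refine hG.false_of_minimal_separator hst ht hc ha hb hab
      (fun x hx => key a b hab x hx (herase x hx))
      (fun x hx => key b a (fun h => hab (h.symm hb)) x hx ((herase x hx).symm ?_))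
    exact fun h => ha (Finset.mem_of_mem_erase h)

theorem reachable_induce_of_linked {T : Set V} {a b : V} (ha : a ∈ T)
    (h : Linked G (· ∈ T) a b) : ∃ hb : b ∈ T, (G.induce T).Reachable ⟨a, ha⟩ ⟨b, hb⟩ := by
  induction h with
  | refl => exact ⟨ha, .refl _⟩
  | @tail b c _ hbc ih =>
    obtain ⟨hb, ih⟩ := ih
    refine ⟨hbc.2, ih.trans (SimpleGraph.Adj.reachable ?_)⟩
    exact hbc.1

/-- Since `k ≤ |V|`, having `|V| ≤ t` would give `2 ^ (t - 4) + 2 ≤ t`, possible only for `t = 6`.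
Then `k = |V| = 6`, which forces `K₆`. -/
theorem IsContractionCritical.lt_card [Finite V] {t k : ℕ} (ht : 6 ≤ t) (hk : 2 ^ (t - 4) + 2 ≤ k)
    (hG : IsContractionCritical k G) (hK : ¬ (t = 6 ∧ k = 6 ∧ G = ⊤)) : t < Nat.card V := by
  have := Fintype.ofFinite V
  have h1 : k ≤ Nat.card V := by
    have := G.colorable_of_fintype.chromaticNumber_le
    rwa [hG.1, Nat.cast_le, ← Nat.card_eq_fintype_card] at this
  by_contra hlt
  obtain ⟨d, rfl⟩ := Nat.exists_eq_add_of_le ht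
  rw [show 6 + d - 4 = d + 2 by omega, pow_add] at hk
  have h2 := two_pow_add_le 0 d
  rw [zero_add] at h2
  have hd : d = 0 := by omega
  subst hd
  have hk6 : k = 6 := by omega
  have hV : Nat.card V = 6 := by omega
  refine hK ⟨rfl, hk6, SimpleGraph.eq_top_of_chromaticNumber_eq_card ?_⟩
  rw [hG.1, ← Nat.card_eq_fintype_card, hk6, hV]

end ContractionCritical

theorem corollary6 {V : Type*} [Finite V] (G : SimpleGraph V) (t k : ℕ)
    (ht : 6 ≤ t) (hk : 2 ^ (t - 4) + 2 ≤ k)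
    (hG : ContractionCritical.IsContractionCritical k G)
    (hK : ¬ (t = 6 ∧ k = 6 ∧ G = ⊤)) :
    ContractionCritical.IsVertexConnected t G := by
  have hcard := hG.lt_card ht hk hK
  refine ⟨?_, fun S hS => ?_⟩
  · rw [ENat.card_eq_coe_natCard]
    exact_mod_cast hcard
  have hfin := S.toFinite
  have hSt : hfin.toFinset.card < t := by
    rw [hfin.encard_eq_coe_toFinset_card] at hS
    exact_mod_cast hS
  have hne : Nonempty (Sᶜ : Set V) := by
    by_contra hn
    rw [not_nonempty_iff, Set.isEmpty_coe_sort, Set.compl_empty_iff] at hn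
    have : S.encard = Nat.card V := by rw [hn, Set.encard_univ, ENat.card_eq_coe_natCard]
    rw [this, Nat.cast_lt] at hS
    omega
  have hcrit := hG.critical (by have := Nat.one_le_two_pow (n := t - 4); omega)
  refine ⟨fun a b => ?_⟩
  have h := hcrit.linked ht (by rw [Fintype.card_fin]; omega) (a := a.1) (b := b.1) hfin.toFinset
    hSt (fun h => a.2 (hfin.mem_toFinset.1 h))
    (fun h => b.2 (hfin.mem_toFinset.1 h))
  obtain ⟨_, h⟩ := ContractionCritical.reachable_induce_of_linked a.2
    (h.mono (Q := (· ∈ Sᶜ)) fun v hv => by simpa using hv)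
  exact h
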